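/- **Theorem 1 (Regret of Multi-G-UCB).** *Setting.* Let $G$ be a connected undirected graph on the nodes $[K]=\{1,\dots,K\}$, with diameter $D$; $N\ge 1$ agents start at given nodes $k_{i,0}$, and in every time step $t=1,2,\dots$ each agent $i$ moves to a neighbouring node $k_{i,t}$ or stays where it is. Let $c_{k,t}$ be the number of agents at node $k$ at time $t$. In each time step a reward $X_{k,t}$ is drawn from a distribution $P_k$ on $[0,1]$ with mean $\mu_k$, independently over nodes and of the past; it is observed if $c_{k,t}>0$. The system receives $R_t=\sum_k f_k(c_{k,t})X_{k,t}$, where the weight functions satisfy $f_k\ge 0$, $f_k(1)=1$ and $f_k(c)\le\gamma c$ for all $k$ and all integers $c\ge0$. Let $C^\ast=(c_k^\ast)$ maximize $\sum_k f_k(c_k)\mu_k$ over the set $\mathcal C$ of vectors of nonnegative integers with $\sum_k c_k=N$. The regret at time $t$ is $\mathcal R_t=\sum_k f_k(c^\ast_k)\mu_k-R_t$. *Algorithm (Multi-G-UCB).* Initialization: each agent runs a depth-first search (with backtracking) of $G$ from its initial node, until all nodes have been visited, i.e. occupied in some time step $t\ge1$; the phase ends not before the agents have jointly visited all nodes, and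 not later than when each agent has visited all of them. After that the algorithm runs in episodes. Let $t_e$ be the first time step of episode $e$, let $n_{k,t}$ be the number of time steps $1\le s<t$ with $c_{k,s}>0$, let $\hat\mu_{k,t}$ be the mean of the rewards $X_{k,s}$ observed in those steps, and let $U_k=\hat\mu_{k,t_e}+\sqrt{2\log(t_e)/n_{k,t_e}}$. Episode $e$ proceeds as follows. 1. Choose $\hat C_e=(\hat c_k)\in\arg\max_{C\in\mathcal C}\sum_k f_k(c_k)U_k$, and let $k_{\min}$ be a node with least $n_{k,t_e}$ among those with $\hat c_k>0$; put $n_{\min}=n_{k_{\min},t_e}$. 2. (SPMatching.) Give each edge, traversed towards node $k$, the weight $\max_v(U_v-U_k)$. A regret shortest path between two nodes is a path of least total weight among the paths with at most $D$ edges. Match the agents with the multiset of destinations that contains each $k$ exactly $\hat c_k$ times, so that the sum over the agents of the weights of the regret shortest paths to their destinations is minimal; all agents follow such paths (waiting at their destination) until they are distributed according to $\hat C_e$. 3. All agents stay in place until $n_{k_{\min},t}\ge 2n_{\min}$; then the next episode starts. Ties, and the orders of the depth-first searches, may be resolved in any (possibly randomized) way that does not depend on future rewards. *Claim.* There is a universal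 constant $B>0$ such that for every such instance, every execution of Multi-G-UCB on it, and every integer $T\ge 2$, the regret accumulated over the first $T$ time steps (including initialization) is integrable and $$\mathbb E\Big[\sum_{t=1}^T\mathcal R_t\Big]\le B\,\gamma N\log(T)\left[\sqrt{KT}+DK\right].$$ -/

import Mathlib

open MeasureTheory ProbabilityTheory

namespace MultiGUCB

noncomputable section

/-! ### The bandit problem: allocations, rewards, regret -/

/-- `count a k`: the number of agents that sit at node `k` when agent `i` sits at `a i`. -/
def count {N K : ℕ} (a : Fin N → Fin K) (k : Fin K) : ℕ :=
  (Finset.univ.filter fun i => a i = k).card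

/-- `C` maximizes `∑ k, f k (c k) * m k` over all allocations of `N` agents to the nodes. -/
def IsOptimalAlloc {K : ℕ} (N : ℕ) (f : Fin K → ℕ → ℝ) (m : Fin K → ℝ)
    (C : Fin K → ℕ) : Prop :=
  (∑ k, C k = N) ∧
    ∀ C' : Fin K → ℕ, ∑ k, C' k = N → ∑ k, f k (C' k) * m k ≤ ∑ k, f k (C k) * m k

/-- The system-wide reward of one time step in which the agents sit at `a` and the
nodes draw the rewards `x`. -/
def reward {N K : ℕ} (f : Fin K → ℕ → ℝ) (a : Fin N → Fin K) (x : Fin K → ℝ) : ℝ :=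
  ∑ k, f k (count a k) * x k

/-- The regret summed over the time steps `1, …, T`, along trajectory `pos` and rewards `x`;
`m` are the mean rewards and `Cstar` is an optimal allocation. -/
def cumRegret {N K : ℕ} (f : Fin K → ℕ → ℝ) (m : Fin K → ℝ) (Cstar : Fin K → ℕ)
    (pos : ℕ → Fin N → Fin K) (x : ℕ → Fin K → ℝ) (T : ℕ) : ℝ :=
  ∑ t ∈ Finset.Icc 1 T, (∑ k, f k (Cstar k) * m k - reward f (pos t) (x t))

/-! ### Statistics and upper confidence bounds -/

/-- The time steps `1 ≤ s < t` at which node `k` is occupied by some agent. -/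
def sampleTimes {N K : ℕ} (pos : ℕ → Fin N → Fin K) (t : ℕ) (k : Fin K) : Finset ℕ :=
  (Finset.Ico 1 t).filter fun s => 0 < count (pos s) k

/-- The number of samples of node `k` available at the beginning of time step `t`. -/
def numSamples {N K : ℕ} (pos : ℕ → Fin N → Fin K) (t : ℕ) (k : Fin K) : ℕ :=
  (sampleTimes pos t k).card

/-- The mean of the rewards of node `k` observed before time step `t`. -/
def empMean {N K : ℕ} (pos : ℕ → Fin N → Fin K) (x : ℕ → Fin K → ℝ) (t : ℕ)
    (k : Fin K) : ℝ :=
  (∑ s ∈ sampleTimes pos t k, x s k) / numSamples pos t k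

/-- The confidence radius of node `k` at time `t`. -/
def confRadius {N K : ℕ} (pos : ℕ → Fin N → Fin K) (t : ℕ) (k : Fin K) : ℝ :=
  Real.sqrt (2 * Real.log t / numSamples pos t k)

/-- The upper confidence bound of node `k` at time `t`. -/
def ucb {N K : ℕ} (pos : ℕ → Fin N → Fin K) (x : ℕ → Fin K → ℝ) (t : ℕ) (k : Fin K) : ℝ :=
  empMean pos x t k + confRadius pos t k

/-! ### Offline planning: `SPMatching` -/

/-- The weight of the edge from `k'` to `k`, given the indices `U`. -/
def edgeWeight {K : ℕ} (U : Fin K → ℝ) (_k' k : Fin K) : ℝ := ⨆ v, (U v - U k)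

/-- The total weight of a walk. -/
def walkWeight {K : ℕ} {G : SimpleGraph (Fin K)} (U : Fin K → ℝ) {u v : Fin K}
    (p : G.Walk u v) : ℝ :=
  (p.darts.map fun d => edgeWeight U d.fst d.snd).sum

/-- `p` is a path of least weight among the paths with the same ends that have at most
`diam G` edges. -/
def IsRegretShortestPath {K : ℕ} {G : SimpleGraph (Fin K)} (U : Fin K → ℝ) {u v : Fin K}
    (p : G.Walk u v) : Prop :=
  p.IsPath ∧ p.length ≤ G.diam ∧
    ∀ q : G.Walk u v, q.IsPath → q.length ≤ G.diam → walkWeight U p ≤ walkWeight U q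

/-- The agents, currently at `cur`, are matched with destinations `dest` that realize the
allocation `C`, and get paths `p` to them: every path is a regret shortest path, and the
total weight is least among all matchings of the agents with the multiset of destinations. -/
structure IsSPMatching {N K : ℕ} (G : SimpleGraph (Fin K)) (U : Fin K → ℝ)
    (cur : Fin N → Fin K) (C : Fin K → ℕ) (dest : Fin N → Fin K)
    (p : ∀ i, G.Walk (cur i) (dest i)) : Prop where
  count_dest : count dest = C
  shortest : ∀ i, IsRegretShortestPath U (p i)
  minimal : ∀ (dest' : Fin N → Fin K) (p' : ∀ i, G.Walk (cur i) (dest' i)),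
    count dest' = C → (∀ i, IsRegretShortestPath U (p' i)) →
      ∑ i, walkWeight U (p i) ≤ ∑ i, walkWeight U (p' i)

/-! ### Initialization: depth-first search -/

/-- One move of a depth-first search. A state consists of the stack (the current node on top)
and the set of discovered nodes. -/
inductive DFSStep {K : ℕ} (G : SimpleGraph (Fin K)) :
    List (Fin K) × Finset (Fin K) → List (Fin K) × Finset (Fin K) → Prop
  | discover (v u : Fin K) (s : List (Fin K)) (vis : Finset (Fin K)) :
      G.Adj v u → u ∉ vis → DFSStep G (v :: s, vis) (u :: v :: s, insert u vis)
  | backtrack (v w : Fin K) (s : List (Fin K)) (vis : Finset (Fin K)) :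
      (∀ u, G.Adj v u → u ∈ vis) → DFSStep G (v :: w :: s, vis) (w :: s, vis)
  | rest (v : Fin K) (vis : Finset (Fin K)) :
      (∀ u, G.Adj v u → u ∈ vis) → DFSStep G ([v], vis) ([v], vis)

/-- The sequence of nodes `w 0, w 1, …` is a depth-first search of `G` from `w 0`
(with backtracking to `w 0`, and staying there afterwards). -/
def IsDFSTour {K : ℕ} (G : SimpleGraph (Fin K)) (w : ℕ → Fin K) : Prop :=
  ∃ st : ℕ → List (Fin K) × Finset (Fin K),
    st 0 = ([w 0], {w 0}) ∧ (∀ t, DFSStep G (st t) (st (t + 1))) ∧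
      ∀ t, (st t).1.head? = some (w t)

/-- The time steps `1, …, τ` form the initialization phase: every agent follows a depth-first
search of its own. A node is visited by being occupied in a time step `≥ 1`, that is, when a
reward is observed there. The phase lasts until all nodes have been visited; it may end as soon
as the agents have visited all nodes jointly, and does not last longer than until each agent
has visited all nodes. -/
structure IsInitPhase {N K : ℕ} (G : SimpleGraph (Fin K)) (pos : ℕ → Fin N → Fin K)
    (τ : ℕ) : Prop where
  dfs : ∃ w : Fin N → ℕ → Fin K, (∀ i, IsDFSTour G (w i)) ∧
    (∀ i, ∀ t ≤ τ, pos t i = w i t) ∧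
    (∀ τ' < τ, ¬ ∀ i k, ∃ t ∈ Finset.Icc 1 τ', w i t = k)
  visited : ∀ k, ∃ i, ∃ t ∈ Finset.Icc 1 τ, pos t i = k

/-! ### The algorithm -/

/-- The time steps `s, …, s' - 1` form an episode of the algorithm: with the indices
`U = ucb pos x s`, a maximizing allocation `C` is chosen, `kmin` is a least sampled node with
`C kmin > 0`, the agents follow `SPMatching` for the `d` time steps it takes until they are
distributed according to `C`, and then stay in place until the number of samples of `kmin` has
doubled (no time step is spent there if it doubled already on the way). -/
def IsEpisode {N K : ℕ} (G : SimpleGraph (Fin K)) (f : Fin K → ℕ → ℝ)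
    (pos : ℕ → Fin N → Fin K) (x : ℕ → Fin K → ℝ) (s s' : ℕ) : Prop :=
  ∃ (C : Fin K → ℕ) (kmin : Fin K) (dest : Fin N → Fin K)
    (p : ∀ i, G.Walk (pos (s - 1) i) (dest i)) (d : ℕ),
    IsOptimalAlloc N f (ucb pos x s) C ∧
    0 < C kmin ∧
    (∀ k, 0 < C k → numSamples pos s kmin ≤ numSamples pos s k) ∧
    IsSPMatching G (ucb pos x s) (pos (s - 1)) C dest p ∧
    IsLeast {r | count (fun i => (p i).getVert r) = C} d ∧
    IsLeast {u | s + d ≤ u ∧ 2 * numSamples pos s kmin ≤ numSamples pos u kmin} s' ∧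
    ∀ t, s ≤ t → t < s' → ∀ i, pos t i = (p i).getVert (min (t + 1 - s) d)

/-- The trajectory `pos` of the agents (`pos t i` is the node of agent `i` at time `t`) is
produced by the algorithm on the rewards `x`, from the initial nodes `start`; `te e` is the
first time step of the `e`-th episode. Ties and the orders of the searches are arbitrary. -/
def IsRun {N K : ℕ} (G : SimpleGraph (Fin K)) (f : Fin K → ℕ → ℝ) (start : Fin N → Fin K)
    (pos : ℕ → Fin N → Fin K) (x : ℕ → Fin K → ℝ) : Prop :=
  pos 0 = start ∧
  ∃ (τ : ℕ) (te : ℕ → ℕ), IsInitPhase G pos τ ∧ te 0 = τ + 1 ∧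
    ∀ e, IsEpisode G f pos x (te e) (te (e + 1))

/-! ### The probabilistic model -/

/-- Rewards of node `k` in the time steps `t ≥ 1` are drawn from `P k`, independently over the
nodes and independently of the past; `ℱ t` is the information available after time step `t`,
which may include randomness that is used to break ties. -/
structure IsRewardProcess {Ω : Type*} {mΩ : MeasurableSpace Ω} (ρ : Measure Ω) {K : ℕ}
    (P : Fin K → Measure ℝ) (ℱ : Filtration ℕ mΩ) (X : ℕ → Fin K → Ω → ℝ) : Prop where
  adapted : ∀ t k, Measurable[ℱ (t + 1)] (X (t + 1) k)
  law : ∀ t k, Measure.map (X (t + 1) k) ρ = P k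
  indep_nodes : ∀ t, iIndepFun (fun k => X (t + 1) k) ρ
  indep_past : ∀ t,
    Indep (MeasurableSpace.comap (fun ω k => X (t + 1) k ω) MeasurableSpace.pi) (ℱ t) ρ

/-- The random trajectory `pos` is an execution of the algorithm: the positions in time step
`t + 1` depend only on the information available after time step `t`, and almost surely the
trajectory is produced by the algorithm on the realized rewards. -/
structure IsExecution {Ω : Type*} {mΩ : MeasurableSpace Ω} (ρ : Measure Ω) {N K : ℕ}
    (G : SimpleGraph (Fin K)) (f : Fin K → ℕ → ℝ) (start : Fin N → Fin K)
    (ℱ : Filtration ℕ mΩ) (X : ℕ → Fin K → Ω → ℝ) (pos : ℕ → Fin N → Ω → Fin K) : Prop where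
  predictable : ∀ t i, Measurable[ℱ t] (pos (t + 1) i)
  run : ∀ᵐ ω ∂ρ, IsRun G f start (fun t i => pos t i ω) (fun t k => X t k ω)

end

end MultiGUCB

namespace MultiGUCB

/-! ### Depth-first search -/

/-! The positions in step `t + 1` are known after step `t`, and the rewards of step `t + 1` are
independent of that past. In expectation rewards may therefore be replaced by their means
(`integral_cumRegret`), and it remains to bound the sum of `gap` along a trajectory
(`IsRun.sum_gap_le`).

Any step costs at most `γ * N`. Initialization takes at most `2 * K` steps. An episode whose least
sampled destination has `n` samples travels for at most `G.diam` steps and then stays for at most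
`n` steps. If the confidence bounds hold at its start, optimism bounds each staying step by `γ * N *
2√(2 log T / n)`, hence the stay by a multiple of `√n`.

Colour each episode by its least sampled node. Doubling makes each `n` exceed the sum of the earlier
ones of its colour, and all of them sum to at most `2 * T`. So there are `O(K log T)` episodes
(`le_log_of_colourSum_lt`), and the `√n` add up to `O(√(K T))` (`sum_sqrt_le_of_colourSum_lt`).

The bounds fail at time `t` with probability at most `2K / t³`, by an exponential supermartingale
and a union bound. An episode starting then costs at most `γ * N * (G.diam + t)`, so failures
contribute `O(γ N K (G.diam + 1))` in total. -/

theorem mem_of_connected_of_adj_closed {V : Type*} {G : SimpleGraph V} (hG : G.Connected)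
    {S : Set V} {r : V} (hr : r ∈ S) (hS : ∀ v ∈ S, ∀ u, G.Adj v u → u ∈ S) (v : V) : v ∈ S := by
  obtain ⟨p⟩ := hG.preconnected r v
  induction p with
  | nil => exact hr
  | cons h p ih => exact ih (hS _ hr _ h)

/-- Invariant of a depth-first search from `w 0` that has run for `t` steps. -/
structure DFSInv {K : ℕ} (G : SimpleGraph (Fin K)) (w : ℕ → Fin K) (t : ℕ)
    (st : List (Fin K) × Finset (Fin K)) : Prop where
  bottom : st.1.getLast? = some (w 0)
  root : w 0 ∈ st.2
  occupied : ∀ v ∈ st.2, ∃ s ≤ t, w s = v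
  closed : ∀ v ∈ st.2, v ∉ st.1 → ∀ u, G.Adj v u → u ∈ st.2

/-- The clause `closed` survives because a node leaves the stack only by backtracking, which
requires all its neighbours to be discovered. -/
theorem DFSInv.step {K : ℕ} {G : SimpleGraph (Fin K)} {w : ℕ → Fin K} {t : ℕ}
    {st st' : List (Fin K) × Finset (Fin K)} (h : DFSInv G w t st) (hstep : DFSStep G st st')
    (hw : st'.1.head? = some (w (t + 1))) : DFSInv G w (t + 1) st' := by
  obtain ⟨h1, h2, h3, h4⟩ := h
  have hocc : ∀ v ∈ st.2, ∃ s ≤ t + 1, w s = v := fun v hv => by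
    obtain ⟨s, hs, rfl⟩ := h3 v hv
    exact ⟨s, by omega, rfl⟩
  cases hstep with
  | discover v u s vis hadj hu =>
    simp only [List.head?_cons, Option.some.injEq] at hw
    refine ⟨?_, ?_, ?_, ?_⟩
    · simpa [List.getLast?_cons_cons] using h1
    · exact Finset.mem_insert_of_mem h2
    · intro a ha
      rcases Finset.mem_insert.1 ha with rfl | ha
      · exact ⟨t + 1, le_rfl, hw.symm⟩
      · exact hocc a ha
    · intro a ha hna b hab
      simp only [List.mem_cons, not_or] at hna
      rcases Finset.mem_insert.1 ha with rfl | ha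
      · exact absurd rfl hna.1
      · exact Finset.mem_insert_of_mem (h4 a ha (by simp [hna.2.1, hna.2.2]) b hab)
  | backtrack v z s vis hv =>
    refine ⟨?_, h2, hocc, ?_⟩
    · simpa [List.getLast?_cons_cons] using h1
    · intro a ha hna b hab
      by_cases hav : a = v
      · exact hv b (hav ▸ hab)
      · refine h4 a ha ?_ b hab
        simp only [List.mem_cons, not_or] at hna ⊢
        exact ⟨hav, hna⟩
  | rest v vis hv => exact ⟨h1, h2, hocc, h4⟩

/-- A depth-first search has visited every node, in the time steps from `1` on, after `2 * K`
steps. -/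
theorem IsDFSTour.exists_mem_Icc {K : ℕ} {G : SimpleGraph (Fin K)} (hG : G.Connected)
    {w : ℕ → Fin K} (hw : IsDFSTour G w) (k : Fin K) : ∃ t ∈ Finset.Icc 1 (2 * K), w t = k := by
  obtain ⟨st, h0, hstep, hhead⟩ := hw
  have hinv : ∀ t, DFSInv G w t (st t) := by
    intro t
    induction t with
    | zero =>
      rw [h0]
      refine ⟨by simp, by simp, ?_, ?_⟩
      · intro v hv
        exact ⟨0, le_rfl, (Finset.mem_singleton.1 hv).symm⟩
      · intro v hv hnv
        exact absurd (Finset.mem_singleton.1 hv) (by simpa using hnv)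
    | succ t ih => exact ih.step (hstep t) (hhead (t + 1))
  -- Until the first `rest`, every move raises `2 * |discovered| - |stack|` by exactly one, so a
  -- `rest` must occur within `2 * K` steps. At that moment only the root is on the stack, and the
  -- discovered set is closed under adjacency, hence everything.
  have hpot : ∀ t, (∃ s < t, w (s + 1) = w 0 ∧ (st (s + 1)).2 = Finset.univ) ∨
      2 * (st t).2.card = (st t).1.length + t + 1 := by
    intro t
    induction t with
    | zero => right; simp [h0]
    | succ t ih =>
      rcases ih with ⟨s, hs, h⟩ | ih
      · exact Or.inl ⟨s, by omega, h⟩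
      have hs := hstep t
      have hi := hinv t
      have hh := hhead (t + 1)
      generalize st t = a at hs hi ih
      generalize hb : st (t + 1) = b at hs hh
      cases hs with
      | discover v u s vis hadj hu =>
        right
        simp only [Finset.card_insert_of_notMem hu, List.length_cons] at ih ⊢
        omega
      | backtrack v z s vis hv =>
        right
        simp only [List.length_cons] at ih ⊢
        omega
      | rest v vis hv =>
        left
        refine ⟨t, by omega, ?_, ?_⟩
        · have := hi.bottom
          simp only [List.getLast?_singleton, List.head?_cons, Option.some.injEq] at this hh
          rw [← hh, this]
        · rw [hb]
          refine Finset.eq_univ_iff_forall.2 fun u => ?_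
          refine mem_of_connected_of_adj_closed hG (S := (vis : Set (Fin K))) hi.root ?_ u
          intro a ha b hab
          by_cases hav : a = v
          · exact hv b (hav ▸ hab)
          · exact hi.closed a ha (by simpa using hav) b hab
  rcases hpot (2 * K) with ⟨s, hs, hroot, huniv⟩ | h
  · obtain ⟨r, hr, hrk⟩ := (hinv (s + 1)).occupied k (huniv ▸ Finset.mem_univ k)
    -- Occupation at time `0` does not count as a visit; the root is instead visited at the resting
    -- time `s + 1`.
    rcases Nat.eq_zero_or_pos r with rfl | hr0
    · exact ⟨s + 1, Finset.mem_Icc.2 ⟨by omega, by omega⟩, hroot.trans hrk⟩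
    · exact ⟨r, Finset.mem_Icc.2 ⟨hr0, by omega⟩, hrk⟩
  · have := Finset.card_le_univ (st (2 * K)).2
    rw [Fintype.card_fin] at this
    omega

theorem IsInitPhase.le {N K : ℕ} {G : SimpleGraph (Fin K)} (hG : G.Connected)
    {pos : ℕ → Fin N → Fin K} {τ : ℕ} (h : IsInitPhase G pos τ) : τ ≤ 2 * K := by
  obtain ⟨w, hw, -, hnot⟩ := h.dfs
  by_contra hlt
  exact hnot (2 * K) (by omega) fun i k => (hw i).exists_mem_Icc hG k

/-! ### Sequences that outgrow their partial sums -/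

/-- Write `n = (√(M + n) - √M) * (√(M + n) + √M)`; the second factor is at most `2√n + √n`. -/
theorem sqrt_le_three_mul_sqrt_add_sub_sqrt {M n : ℝ} (hM : 0 ≤ M) (h : M ≤ n) :
    √n ≤ 3 * (√(M + n) - √M) := by
  have hn : 0 ≤ n := hM.trans h
  have h1 : √M ≤ √n := Real.sqrt_le_sqrt h
  have h2 : √(M + n) ≤ 2 * √n := by
    rw [show 2 * √n = √(4 * n) by
      rw [Real.sqrt_mul (by norm_num), show (4 : ℝ) = 2 ^ 2 by norm_num, Real.sqrt_sq (by norm_num)]]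
    exact Real.sqrt_le_sqrt (by linarith)
  have h3 := Real.sqrt_nonneg M
  have h4 : √M ≤ √(M + n) := Real.sqrt_le_sqrt (by linarith)
  have e1 := Real.sq_sqrt hM
  have e2 := Real.sq_sqrt hn
  have e3 := Real.sq_sqrt (add_nonneg hM hn)
  rcases (Real.sqrt_nonneg n).eq_or_lt with h0 | h0
  · linarith
  · have : √n * √n ≤ 3 * (√(M + n) - √M) * √n := by nlinarith
    exact le_of_mul_le_mul_right this h0

section Doubling

variable {ι : Type*} [DecidableEq ι] {c : ℕ → ι} {n : ℕ → ℕ} {E T : ℕ}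

/-- The sum of the terms of `n` up to `e` (exclusive) that have colour `k`. -/
def colourSum (c : ℕ → ι) (n : ℕ → ℕ) (e : ℕ) (k : ι) : ℕ :=
  ∑ i ∈ Finset.range e, if c i = k then n i else 0

theorem colourSum_succ (e : ℕ) (k : ι) :
    colourSum c n (e + 1) k = colourSum c n e k + if c e = k then n e else 0 :=
  Finset.sum_range_succ _ _

variable [Fintype ι]

theorem sum_colourSum (e : ℕ) : ∑ k, colourSum c n e k = ∑ i ∈ Finset.range e, n i := by
  unfold colourSum
  rw [Finset.sum_comm]
  simp

/-- Each `√(n e)` is at most three times the increment of the root of its colour sum. The increments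
telescope, and Cauchy–Schwarz over the colours, whose sums total at most `2 * T`, finishes. -/
theorem sum_sqrt_le_of_colourSum_lt (h : ∀ e < E, colourSum c n e (c e) < n e)
    (hT : ∑ e ∈ Finset.range E, n e ≤ 2 * T) :
    ∑ e ∈ Finset.range E, √(n e : ℝ) ≤ 3 * √(2 * (Fintype.card ι * T)) := by
  have key : ∀ e ≤ E, ∑ i ∈ Finset.range e, √(n i : ℝ) ≤
      3 * ∑ k, √(colourSum c n e k : ℝ) := by
    intro e
    induction e with
    | zero => intro _; simp only [Finset.range_zero, Finset.sum_empty]; positivity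
    | succ e ih =>
      intro he
      rw [Finset.sum_range_succ]
      have h1 := ih (by omega)
      have h2 : √(n e : ℝ) ≤ 3 * ∑ k, (√(colourSum c n (e + 1) k : ℝ) -
          √(colourSum c n e k : ℝ)) := by
        have h3 : √(n e : ℝ) ≤ 3 * (√(colourSum c n (e + 1) (c e) : ℝ) -
            √(colourSum c n e (c e) : ℝ)) := by
          rw [colourSum_succ, if_pos rfl, Nat.cast_add]
          exact sqrt_le_three_mul_sqrt_add_sub_sqrt (Nat.cast_nonneg _)
            (by exact_mod_cast (h e (by omega)).le)
        refine h3.trans (mul_le_mul_of_nonneg_left ?_ (by norm_num))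
        refine Finset.single_le_sum (f := fun k => √(colourSum c n (e + 1) k : ℝ) -
          √(colourSum c n e k : ℝ)) (fun k _ => ?_) (Finset.mem_univ (c e))
        rw [sub_nonneg, colourSum_succ]
        exact Real.sqrt_le_sqrt (by push_cast; simp; positivity)
      rw [Finset.sum_sub_distrib] at h2
      linarith
  refine (key E le_rfl).trans (mul_le_mul_of_nonneg_left ?_ (by norm_num))
  refine Real.le_sqrt_of_sq_le ?_
  refine sq_sum_le_card_mul_sum_sq.trans ?_
  simp only [Real.sq_sqrt (Nat.cast_nonneg _), Finset.card_univ]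
  rw [← Nat.cast_sum, sum_colourSum]
  have : ((∑ e ∈ Finset.range E, n e : ℕ) : ℝ) ≤ 2 * T := by exact_mod_cast hT
  calc _ ≤ (Fintype.card ι : ℝ) * (2 * T) := by gcongr
    _ = _ := by ring

/-- Each term of a colour at least doubles one plus its colour sum, so `j` episodes of one colour
force `2 ^ j ≤ 1 + 2 * T ≤ T ^ 3`; the constant is `3 / log 2 < 5`. -/
theorem le_log_of_colourSum_lt (hT2 : 2 ≤ T) (h : ∀ e < E, colourSum c n e (c e) < n e)
    (hT : ∑ e ∈ Finset.range E, n e ≤ 2 * T) :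
    (E : ℝ) ≤ 5 * (Fintype.card ι * Real.log T) := by
  -- With all terms equal to `1`, `colourSum` counts the episodes of colour `k`.
  have key : ∀ k, ∀ e ≤ E, 2 ^ (colourSum c (fun _ => 1) e k) ≤ 1 + colourSum c n e k := by
    intro k e
    induction e with
    | zero => intro _; simp [colourSum]
    | succ e ih =>
      intro he
      have h1 := ih (by omega)
      rw [colourSum_succ, colourSum_succ]
      by_cases hk : c e = k
      · have h2 := h e (by omega)
        rw [hk] at h2
        rw [if_pos hk, if_pos hk, pow_succ]
        omega
      · simpa [if_neg hk] using h1
  have hTR : (2 : ℝ) ≤ T := by exact_mod_cast hT2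
  have hk : ∀ k, (colourSum c (fun _ => 1) E k : ℝ) ≤ 5 * Real.log T := by
    intro k
    have h1 := key k E le_rfl
    have h2 : colourSum c n E k ≤ 2 * T := by
      refine le_trans ?_ hT
      rw [← sum_colourSum (c := c)]
      exact Finset.single_le_sum (f := fun k => colourSum c n E k) (fun _ _ => Nat.zero_le _)
        (Finset.mem_univ k)
    have h3 : (2 : ℝ) ^ (colourSum c (fun _ => 1) E k) ≤ (T : ℝ) ^ 3 := by
      have : ((2 ^ (colourSum c (fun _ => 1) E k) : ℕ) : ℝ) ≤ ((1 + 2 * T : ℕ) : ℝ) := by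
        exact_mod_cast h1.trans (by omega)
      push_cast at this
      have h4 : (4 : ℝ) * T ≤ T ^ 3 := by
        -- `T³ - 4T = T (T - 2) (T + 2)`.
        nlinarith [mul_nonneg (mul_nonneg (by linarith : (0 : ℝ) ≤ T) (sub_nonneg.2 hTR))
          (by linarith : (0 : ℝ) ≤ T + 2)]
      linarith
    have h4 := Real.log_le_log (by positivity) h3
    rw [Real.log_pow, Real.log_pow] at h4
    have h5 := Real.log_two_gt_d9
    have h6 : (0 : ℝ) ≤ colourSum c (fun _ => 1) E k := Nat.cast_nonneg _
    push_cast at h4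
    nlinarith
  have hE : (E : ℝ) = ∑ k, (colourSum c (fun _ => 1) E k : ℝ) := by
    rw [← Nat.cast_sum, sum_colourSum]
    simp
  rw [hE]
  refine (Finset.sum_le_sum fun k _ => hk k).trans (le_of_eq ?_)
  simp only [Finset.sum_const, Finset.card_univ, nsmul_eq_mul]
  ring

end Doubling

/-! ### Allocations and instantaneous regret -/

theorem sum_count {N K : ℕ} (a : Fin N → Fin K) : ∑ k, count a k = N := by
  unfold count
  rw [← Finset.card_eq_sum_card_fiberwise (fun _ _ => by simp), Finset.card_univ, Fintype.card_fin]

/-- The expected regret of one time step in which the agents sit at `a`. -/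
noncomputable def gap {N K : ℕ} (f : Fin K → ℕ → ℝ) (m : Fin K → ℝ) (Cstar : Fin K → ℕ)
    (a : Fin N → Fin K) : ℝ :=
  ∑ k, f k (Cstar k) * m k - reward f a m

/-- Weight functions that are nonnegative and grow at most linearly with rate `γ`. -/
structure IsWeight {K : ℕ} (f : Fin K → ℕ → ℝ) (γ : ℝ) : Prop where
  nonneg : ∀ k c, 0 ≤ f k c
  le : ∀ k c, f k c ≤ γ * c

section Weight

variable {N K : ℕ} {f : Fin K → ℕ → ℝ} {γ : ℝ} {m : Fin K → ℝ} {Cstar : Fin K → ℕ}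

/-- Unoccupied nodes contribute nothing, since `f k 0` is squeezed between `0` and `γ * 0`; hence
`g` need only be bounded where `C` is positive. -/
theorem IsWeight.sum_mul_le (hf : IsWeight f γ) {C : Fin K → ℕ} (hC : ∑ k, C k = N)
    {g : Fin K → ℝ} {b : ℝ} (hb : 0 ≤ b) (hg : ∀ k, 0 < C k → g k ≤ b) :
    ∑ k, f k (C k) * g k ≤ γ * N * b := by
  have h : ∀ k ∈ Finset.univ, f k (C k) * g k ≤ γ * C k * b := by
    intro k _
    rcases Nat.eq_zero_or_pos (C k) with h0 | h0
    · have h1 := hf.le k 0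
      have h2 := hf.nonneg k 0
      simp only [Nat.cast_zero, mul_zero] at h1
      simp [h0, le_antisymm h1 h2]
    · exact (mul_le_mul_of_nonneg_left (hg k h0) (hf.nonneg _ _)).trans
        (mul_le_mul_of_nonneg_right (hf.le _ _) hb)
  refine (Finset.sum_le_sum h).trans (le_of_eq ?_)
  rw [← Finset.sum_mul, ← Finset.mul_sum, ← Nat.cast_sum, hC]

theorem IsWeight.gap_le (hf : IsWeight f γ) (hm0 : ∀ k, 0 ≤ m k)
    (hm1 : ∀ k, m k ≤ 1) (hC : ∑ k, Cstar k = N) (a : Fin N → Fin K) :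
    gap f m Cstar a ≤ γ * N := by
  have h1 := hf.sum_mul_le hC zero_le_one (fun k _ => hm1 k)
  have h2 : 0 ≤ reward f a m :=
    Finset.sum_nonneg fun k _ => mul_nonneg (hf.nonneg _ _) (hm0 k)
  unfold gap
  linarith

theorem gap_nonneg (hC : IsOptimalAlloc N f m Cstar) (a : Fin N → Fin K) :
    0 ≤ gap f m Cstar a :=
  sub_nonneg.2 (hC.2 _ (sum_count a))

end Weight

/-! ### Samples -/

section Samples

variable {N K : ℕ} {pos : ℕ → Fin N → Fin K} {k : Fin K}

theorem sampleTimes_mono {s t : ℕ} (h : s ≤ t) : sampleTimes pos s k ⊆ sampleTimes pos t k :=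
  Finset.filter_subset_filter _ (Finset.Ico_subset_Ico_right h)

theorem numSamples_mono {s t : ℕ} (h : s ≤ t) : numSamples pos s k ≤ numSamples pos t k :=
  Finset.card_le_card (sampleTimes_mono h)

theorem numSamples_add_one_le {t : ℕ} (ht : 1 ≤ t) : numSamples pos t k + 1 ≤ t := by
  have h := Finset.card_filter_le (Finset.Ico 1 t) fun s => 0 < count (pos s) k
  rw [Nat.card_Ico] at h
  unfold numSamples sampleTimes
  omega

theorem sampleTimes_succ {t : ℕ} (ht : 1 ≤ t) : sampleTimes pos (t + 1) k =
    if 0 < count (pos t) k then insert t (sampleTimes pos t k) else sampleTimes pos t k := by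
  have h : Finset.Ico 1 (t + 1) = insert t (Finset.Ico 1 t) := by
    ext r
    simp only [Finset.mem_Ico, Finset.mem_insert]
    omega
  unfold sampleTimes
  rw [h, Finset.filter_insert]

theorem notMem_sampleTimes (t : ℕ) : t ∉ sampleTimes pos t k := by
  simp [sampleTimes]

theorem numSamples_succ {t : ℕ} (ht : 1 ≤ t) : numSamples pos (t + 1) k =
    numSamples pos t k + if 0 < count (pos t) k then 1 else 0 := by
  unfold numSamples
  rw [sampleTimes_succ ht]
  split_ifs with h
  · rw [Finset.card_insert_of_notMem (notMem_sampleTimes t)]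
  · rfl

theorem numSamples_le_add {s t : ℕ} (hs : 1 ≤ s) (h : s ≤ t) :
    numSamples pos t k ≤ numSamples pos s k + (t - s) := by
  induction t, h using Nat.le_induction with
  | base => simp
  | succ t h ih =>
    rw [numSamples_succ (hs.trans h)]
    split_ifs <;> omega

theorem numSamples_eq_add {s t : ℕ} (hs : 1 ≤ s) (h : s ≤ t)
    (hocc : ∀ r, s ≤ r → r < t → 0 < count (pos r) k) :
    numSamples pos t k = numSamples pos s k + (t - s) := by
  induction t, h using Nat.le_induction with
  | base => simp
  | succ t h ih =>
    rw [numSamples_succ (hs.trans h), if_pos (hocc t h (by omega)),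
      ih fun r h1 h2 => hocc r h1 (by omega)]
    omega

theorem numSamples_pos_of_visited {τ t : ℕ} {i : Fin N}
    (h : ∃ t ∈ Finset.Icc 1 τ, pos t i = k) (ht : τ < t) : 1 ≤ numSamples pos t k := by
  obtain ⟨r, hr, hrk⟩ := h
  rw [Finset.mem_Icc] at hr
  refine Finset.card_pos.2 ⟨r, Finset.mem_filter.2 ⟨Finset.mem_Ico.2 ⟨hr.1, by omega⟩, ?_⟩⟩
  exact Finset.card_pos.2 ⟨i, by simp [hrk]⟩

end Samples

/-! ### One episode -/

/-- The empirical means of all sampled nodes are within the confidence radius of the true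
means. -/
def IsGoodTime {N K : ℕ} (m : Fin K → ℝ) (pos : ℕ → Fin N → Fin K) (x : ℕ → Fin K → ℝ)
    (t : ℕ) : Prop :=
  ∀ k, 0 < numSamples pos t k → |empMean pos x t k - m k| ≤ confRadius pos t k

section Episode

variable {N K : ℕ} {G : SimpleGraph (Fin K)} {f : Fin K → ℕ → ℝ} {γ : ℝ} {m : Fin K → ℝ}
  {Cstar : Fin K → ℕ} {pos : ℕ → Fin N → Fin K} {x : ℕ → Fin K → ℝ}

/-- At a good time, an allocation that is optimal for the confidence bounds has small regret. -/
theorem IsGoodTime.gap_le {s n : ℕ} (hgood : IsGoodTime m pos x s)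
    (hsamp : ∀ k, 1 ≤ numSamples pos s k) (hf : IsWeight f γ)
    (hCstar : ∑ k, Cstar k = N) {C : Fin K → ℕ} (hn : 0 < n)
    (hC : IsOptimalAlloc N f (ucb pos x s) C)
    (hmin : ∀ k, 0 < C k → n ≤ numSamples pos s k) {a : Fin N → Fin K} (ha : count a = C) :
    gap f m Cstar a ≤ γ * N * (2 * √(2 * Real.log s / n)) := by
  -- Optimism: the optimum is worth at most its index value, which is at most that of `C`, and the
  -- latter overestimates the mean value of `C` by at most two confidence radii per node used.
  have h1 : ∑ k, f k (Cstar k) * m k ≤ ∑ k, f k (Cstar k) * ucb pos x s k := by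
    refine Finset.sum_le_sum fun k _ => mul_le_mul_of_nonneg_left ?_ (hf.nonneg _ _)
    have := (abs_le.1 (hgood k (hsamp k))).1
    unfold ucb
    linarith
  have h2 := hC.2 Cstar hCstar
  have h3 : ∑ k, f k (C k) * (ucb pos x s k - m k) ≤ γ * N * (2 * √(2 * Real.log s / n)) := by
    refine hf.sum_mul_le hC.1 (by positivity) fun k hk => ?_
    have h4 := (abs_le.1 (hgood k (hsamp k))).2
    have h5 : confRadius pos s k ≤ √(2 * Real.log s / n) := by
      refine Real.sqrt_le_sqrt ?_
      have := Real.log_natCast_nonneg s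
      have hn' : (0 : ℝ) < n := by exact_mod_cast hn
      have hk' : (n : ℝ) ≤ numSamples pos s k := by exact_mod_cast hmin k hk
      exact div_le_div_of_nonneg_left (by positivity) hn' hk'
    unfold ucb
    linarith
  simp only [mul_sub, Finset.sum_sub_distrib] at h3
  unfold gap reward
  rw [ha]
  linarith

/-- The shape of an episode: after at most `G.diam` steps of travel the agents stay, in an
allocation of small regret, for at most as long as the least sampled node had been sampled. -/
theorem IsEpisode.exists_bounds {s s' : ℕ} (h : IsEpisode G f pos x s s') (hs : 1 ≤ s)
    (hsamp : ∀ k, 1 ≤ numSamples pos s k) (hf : IsWeight f γ)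
    (hCstar : ∑ k, Cstar k = N) :
    ∃ (k : Fin K) (d : ℕ), d ≤ G.diam ∧ s < s' ∧ s + d ≤ s' ∧
      2 * numSamples pos s k ≤ numSamples pos s' k ∧ s' ≤ s + d + numSamples pos s k ∧
      (IsGoodTime m pos x s → ∀ t, s + d ≤ t → t < s' →
        gap f m Cstar (pos t) ≤ γ * N * (2 * √(2 * Real.log s / numSamples pos s k))) := by
  obtain ⟨C, k, dest, p, d, hC, hk, hmin, hsp, hd, hs', hpos⟩ := h
  have hdD : d ≤ G.diam := by
    -- `getVert` is constant beyond the end of a walk, so after `G.diam` steps every agent is at its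
    -- destination.
    refine hd.2 ?_
    have : (fun i => (p i).getVert G.diam) = dest :=
      funext fun i => (p i).getVert_of_length_le (hsp.shortest i).2.1
    rw [Set.mem_ofPred_eq, this, hsp.count_dest]
  have hstay : ∀ t, s + d ≤ t → t < s' → count (pos t) = C := by
    intro t h1 h2
    have : pos t = fun i => (p i).getVert d := funext fun i => by
      rw [hpos t (by omega) h2 i, min_eq_right (by omega)]
    rw [this, hd.1]
  have hsd := hs'.1.1
  have h2n := hs'.1.2
  have hlt : s < s' := by
    refine lt_of_le_of_ne (by omega) ?_
    rintro rfl
    have := hsamp k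
    omega
  refine ⟨k, d, hdD, hlt, hsd, h2n, ?_, ?_⟩
  · by_contra hcon
    have hu : s + d + numSamples pos s k < s' := by omega
    have h3 := numSamples_eq_add (pos := pos) (k := k) (s := s + d)
      (t := s + d + numSamples pos s k) (by omega) (by omega)
      (fun r h1 h2 => by rw [hstay r h1 (by omega)]; exact hk)
    have h4 := numSamples_mono (pos := pos) (k := k) (show s ≤ s + d by omega)
    have h5 := hs'.2 (show s + d + numSamples pos s k ∈ _ from ⟨by omega, by omega⟩)
    omega
  · intro hgood t h1 h2
    exact hgood.gap_le hsamp hf hCstar (hsamp k) hC hmin (hstay t h1 h2)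

open Classical in
/-- The regret of an episode. -/
theorem IsEpisode.exists_sum_gap_le {s s' : ℕ} (h : IsEpisode G f pos x s s') (hs : 1 ≤ s)
    (hsamp : ∀ k, 1 ≤ numSamples pos s k) (hf : IsWeight f γ) (hγ : 0 ≤ γ)
    (hm0 : ∀ k, 0 ≤ m k) (hm1 : ∀ k, m k ≤ 1) (hCstar : ∑ k, Cstar k = N) :
    ∃ k : Fin K, s < s' ∧ 2 * numSamples pos s k ≤ numSamples pos s' k ∧
      ∑ t ∈ Finset.Ico s s', gap f m Cstar (pos t) ≤
        γ * N * (G.diam + 2 * √(2 * Real.log s) * √(numSamples pos s k) +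
          if IsGoodTime m pos x s then 0 else (G.diam + s : ℝ)) := by
  obtain ⟨k, d, hd, hlt, hsd, h2n, hs', hgap⟩ := h.exists_bounds (m := m) hs hsamp hf hCstar
  refine ⟨k, hlt, h2n, ?_⟩
  set n := numSamples pos s k with hn
  have hn1 : 1 ≤ n := hsamp k
  have hγN : 0 ≤ γ * N := by positivity
  have hall : ∀ t, gap f m Cstar (pos t) ≤ γ * N := fun t =>
    hf.gap_le hm0 hm1 hCstar (pos t)
  have hdR : (d : ℝ) ≤ G.diam := by exact_mod_cast hd
  by_cases hgood : IsGoodTime m pos x s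
  · rw [if_pos hgood, ← Finset.sum_Ico_consecutive _ (Nat.le_add_right s d) hsd]
    have h1 : ∑ t ∈ Finset.Ico s (s + d), gap f m Cstar (pos t) ≤ d * (γ * N) := by
      refine (Finset.sum_le_card_nsmul _ _ _ fun t _ => hall t).trans (le_of_eq ?_)
      simp
    have h2 : ∑ t ∈ Finset.Ico (s + d) s', gap f m Cstar (pos t) ≤
        n * (γ * N * (2 * √(2 * Real.log s / n))) := by
      refine (Finset.sum_le_card_nsmul _ _ _ fun t ht => hgap hgood t
        (Finset.mem_Ico.1 ht).1 (Finset.mem_Ico.1 ht).2).trans ?_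
      rw [nsmul_eq_mul, Nat.card_Ico]
      refine mul_le_mul_of_nonneg_right ?_ (by positivity)
      exact_mod_cast (by omega : s' - (s + d) ≤ n)
    -- Staying `n` steps at a cost of order `1 / √n` each costs order `√n`.
    have h3 : n * (γ * N * (2 * √(2 * Real.log s / n))) =
        γ * N * (2 * √(2 * Real.log s) * √n) := by
      rw [Real.sqrt_div (by have := Real.log_natCast_nonneg s; positivity)]
      have : √(n : ℝ) ≠ 0 := (Real.sqrt_pos.2 (by exact_mod_cast hn1)).ne'
      field_simp
      rw [Real.sq_sqrt (Nat.cast_nonneg n)]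
      ring
    have h4 : d * (γ * N) ≤ γ * N * G.diam := by nlinarith
    nlinarith
  · rw [if_neg hgood]
    have h1 : ∑ t ∈ Finset.Ico s s', gap f m Cstar (pos t) ≤ (s' - s : ℕ) * (γ * N) := by
      refine (Finset.sum_le_card_nsmul _ _ _ fun t _ => hall t).trans (le_of_eq ?_)
      simp
    -- A node has fewer than `s` samples at time `s`, which bounds the length of the stay without
    -- confidence bounds.
    have h2 : ((s' - s : ℕ) : ℝ) ≤ G.diam + s := by
      have := numSamples_add_one_le (pos := pos) (k := k) hs
      exact_mod_cast (by omega : s' - s ≤ G.diam + s)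
    have h3 : ((s' - s : ℕ) : ℝ) * (γ * N) ≤ (G.diam + s) * (γ * N) :=
      mul_le_mul_of_nonneg_right h2 hγN
    have h4 : 0 ≤ γ * N * (G.diam + 2 * √(2 * Real.log s) * √n) := by positivity
    nlinarith

end Episode

/-! ### The regret along one trajectory -/

section Pathwise

variable {N K : ℕ} {G : SimpleGraph (Fin K)} {f : Fin K → ℕ → ℝ} {γ : ℝ} {m : Fin K → ℝ}
  {Cstar : Fin K → ℕ} {start : Fin N → Fin K} {pos : ℕ → Fin N → Fin K} {x : ℕ → Fin K → ℝ}

theorem sum_Ico_seq_eq {te : ℕ → ℕ} (hte : StrictMono te) (h1 : 1 ≤ te 0) (g : ℕ → ℝ) (E : ℕ) :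
    ∑ t ∈ Finset.Ico 1 (te E), g t = ∑ t ∈ Finset.Ico 1 (te 0), g t +
      ∑ e ∈ Finset.range E, ∑ t ∈ Finset.Ico (te e) (te (e + 1)), g t := by
  induction E with
  | zero => simp
  | succ E ih =>
    rw [Finset.sum_range_succ, ← add_assoc, ← ih, Finset.sum_Ico_consecutive]
    · exact h1.trans (hte.monotone (Nat.zero_le E))
    · exact hte.monotone (Nat.le_succ E)

/-- If node `c e` at least doubles its samples in episode `e`, for every `e`, then a node has
more samples than it had in total at the beginnings of its earlier episodes. -/
theorem colourSum_lt_numSamples {te : ℕ → ℕ} (hte : StrictMono te) {c : ℕ → Fin K}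
    (hsamp : ∀ k, 1 ≤ numSamples pos (te 0) k)
    (h2 : ∀ e, 2 * numSamples pos (te e) (c e) ≤ numSamples pos (te (e + 1)) (c e)) (e : ℕ)
    (k : Fin K) :
    colourSum c (fun e => numSamples pos (te e) (c e)) e k < numSamples pos (te e) k := by
  induction e with
  | zero => exact lt_of_eq_of_lt (by simp [colourSum]) (hsamp k)
  | succ e ih =>
    rw [colourSum_succ]
    split_ifs with hk
    · have := h2 e
      rw [hk] at this ⊢
      omega
    · have := numSamples_mono (pos := pos) (k := k) (hte.monotone (Nat.le_add_right e 1))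
      omega

/-- By doubling, `n e` is at most the number of new samples, hence the length, of episode `e`. The
episodes before the last fit into `T` steps; the last may overrun `T`, but its `n` is below its
starting time. -/
theorem sum_numSamples_le {te : ℕ → ℕ} (hte : StrictMono te) (h1 : 1 ≤ te 0) {c : ℕ → Fin K}
    (h2 : ∀ e, 2 * numSamples pos (te e) (c e) ≤ numSamples pos (te (e + 1)) (c e)) {E T : ℕ}
    (hE : ∀ e < E, te e ≤ T) :
    ∑ e ∈ Finset.range E, numSamples pos (te e) (c e) ≤ 2 * T := by
  have h3 : ∀ e, numSamples pos (te e) (c e) ≤ te (e + 1) - te e := fun e => by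
    have := numSamples_le_add (pos := pos) (k := c e)
      (h1.trans (hte.monotone (Nat.zero_le e))) (hte.monotone (Nat.le_add_right e 1))
    have := h2 e
    omega
  cases E with
  | zero => simp
  | succ E =>
    have h4 := numSamples_add_one_le (pos := pos) (k := c E) (h1.trans (hte.monotone E.zero_le))
    have h5 := hE E (Nat.lt_succ_self E)
    have h6 := Finset.sum_le_sum fun e (_ : e ∈ Finset.range E) => h3 e
    rw [Finset.sum_range_tsub hte.monotone] at h6
    rw [Finset.sum_range_succ]
    omega

open Classical in
/-- Every run of the algorithm has small expected regret, up to the cost of the time steps at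
which the confidence bounds fail. -/
theorem IsRun.sum_gap_le (h : IsRun G f start pos x) (hG : G.Connected)
    (hf : IsWeight f γ) (hγ : 0 ≤ γ) (hm0 : ∀ k, 0 ≤ m k) (hm1 : ∀ k, m k ≤ 1)
    (hCstar : IsOptimalAlloc N f m Cstar) {T : ℕ} (hT : 2 ≤ T) :
    ∑ t ∈ Finset.Icc 1 T, gap f m Cstar (pos t) ≤
      γ * N * (2 * K + 5 * (K * Real.log T) * G.diam +
        2 * √(2 * Real.log T) * (3 * √(2 * (K * T)))) +
      ∑ t ∈ Finset.Icc 2 T, if IsGoodTime m pos x t then 0 else γ * N * (G.diam + t) := by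
  obtain ⟨-, τ, te, hinit, hte0, hep⟩ := h
  -- This puts every episode start at time `2` or later, where the failure costs are summed.
  have hτ1 : 1 ≤ τ := by
    obtain ⟨i, t, ht, -⟩ := hinit.visited (hG.nonempty.some)
    rw [Finset.mem_Icc] at ht
    omega
  have hsamp0 : ∀ k, 1 ≤ numSamples pos (te 0) k := fun k => by
    obtain ⟨i, hi⟩ := hinit.visited k
    exact numSamples_pos_of_visited hi (by omega)
  have hγN : 0 ≤ γ * N := by positivity
  have hall : ∀ e, 2 ≤ te e ∧ te 0 ≤ te e := by
    intro e
    induction e with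
    | zero => exact ⟨by omega, le_rfl⟩
    | succ e ih =>
      obtain ⟨k, hlt, -⟩ := (hep e).exists_sum_gap_le (by omega)
        (fun k => (hsamp0 k).trans (numSamples_mono ih.2)) hf hγ hm0 hm1 hCstar.1
      omega
  have hsamp : ∀ e k, 1 ≤ numSamples pos (te e) k := fun e k =>
    (hsamp0 k).trans (numSamples_mono (hall e).2)
  choose c hlt h2n hsum using fun e => (hep e).exists_sum_gap_le (by have := hall e; omega)
    (hsamp e) hf hγ hm0 hm1 hCstar.1
  have hte : StrictMono te := strictMono_nat_of_lt_succ hlt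
  have hex : ∃ e, T < te e := ⟨T + 1, lt_of_lt_of_le (Nat.lt_succ_self T) (hte.id_le _)⟩
  obtain ⟨E, hE, hEmin⟩ : ∃ E, T < te E ∧ ∀ e < E, te e ≤ T :=
    ⟨Nat.find hex, Nat.find_spec hex, fun e he => not_lt.1 (Nat.find_min hex he)⟩
  have hgap0 : ∀ t, 0 ≤ gap f m Cstar (pos t) := fun t => gap_nonneg hCstar _
  have hgrow : ∀ e < E, colourSum c (fun e => numSamples pos (te e) (c e)) e (c e) <
      numSamples pos (te e) (c e) := fun e _ =>
    colourSum_lt_numSamples hte hsamp0 h2n e (c e)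
  have htotal := sum_numSamples_le hte (by omega) h2n hEmin
  have hcount := le_log_of_colourSum_lt hT hgrow htotal
  have hsqrt := sum_sqrt_le_of_colourSum_lt hgrow htotal
  rw [Fintype.card_fin] at hcount hsqrt
  -- The last episode may run beyond `T`. It can be counted in full because `gap`, unlike the
  -- realized regret, is nonnegative.
  have hstep1 : ∑ t ∈ Finset.Icc 1 T, gap f m Cstar (pos t) ≤
      ∑ t ∈ Finset.Ico 1 (te E), gap f m Cstar (pos t) := by
    refine Finset.sum_le_sum_of_subset_of_nonneg ?_ fun t _ _ => hgap0 t
    intro t ht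
    rw [Finset.mem_Icc] at ht
    exact Finset.mem_Ico.2 ⟨ht.1, by omega⟩
  rw [sum_Ico_seq_eq hte (by omega)] at hstep1
  have hstep2 : ∑ t ∈ Finset.Ico 1 (te 0), gap f m Cstar (pos t) ≤ γ * N * (2 * K) := by
    refine (Finset.sum_le_card_nsmul _ _ _ fun t _ =>
      hf.gap_le hm0 hm1 hCstar.1 (pos t)).trans ?_
    rw [nsmul_eq_mul, mul_comm, Nat.card_Ico]
    refine mul_le_mul_of_nonneg_left ?_ hγN
    have := hinit.le hG
    exact_mod_cast (by omega : te 0 - 1 ≤ 2 * K)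
  have hstep3 : ∀ e ∈ Finset.range E, ∑ t ∈ Finset.Ico (te e) (te (e + 1)), gap f m Cstar (pos t) ≤
      γ * N * (G.diam + 2 * √(2 * Real.log T) * √(numSamples pos (te e) (c e))) +
        if IsGoodTime m pos x (te e) then 0 else γ * N * (G.diam + (te e : ℕ) : ℝ) := by
    intro e he
    refine (hsum e).trans ?_
    rw [mul_add]
    refine add_le_add (mul_le_mul_of_nonneg_left ?_ hγN) (le_of_eq (by split_ifs <;> simp))
    have h1 : Real.log (te e) ≤ Real.log T := by
      refine Real.log_le_log ?_ ?_
      · exact_mod_cast (by have := hall e; omega : 0 < te e)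
      · exact_mod_cast hEmin e (Finset.mem_range.1 he)
    gcongr
  -- Distinct episodes start at distinct times, so each failure time is charged at most once.
  have hstep4 : ∑ e ∈ Finset.range E,
      (if IsGoodTime m pos x (te e) then 0 else γ * N * (G.diam + (te e : ℕ) : ℝ)) ≤
      ∑ t ∈ Finset.Icc 2 T, if IsGoodTime m pos x t then 0 else γ * N * (G.diam + t : ℝ) := by
    rw [← Finset.sum_image (f := fun t : ℕ =>
      if IsGoodTime m pos x t then 0 else γ * N * (G.diam + t : ℝ))
      (g := te) (fun a _ b _ hab => hte.injective hab)]
    refine Finset.sum_le_sum_of_subset_of_nonneg ?_ fun t _ _ => by split_ifs <;> positivity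
    intro t ht
    obtain ⟨e, he, rfl⟩ := Finset.mem_image.1 ht
    exact Finset.mem_Icc.2 ⟨(hall e).1, hEmin e (Finset.mem_range.1 he)⟩
  have hstep5 := Finset.sum_le_sum hstep3
  rw [Finset.sum_add_distrib, ← Finset.mul_sum, Finset.sum_add_distrib, ← Finset.mul_sum,
    Finset.sum_const, Finset.card_range, nsmul_eq_mul] at hstep5
  have hstep6 : γ * N * (E * G.diam + 2 * √(2 * Real.log T) *
      ∑ e ∈ Finset.range E, √(numSamples pos (te e) (c e) : ℝ)) ≤
      γ * N * (5 * (K * Real.log T) * G.diam + 2 * √(2 * Real.log T) * (3 * √(2 * (K * T)))) := by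
    gcongr
  have hsplit : γ * N * (2 * K + 5 * (K * Real.log T) * G.diam +
      2 * √(2 * Real.log T) * (3 * √(2 * (K * T)))) = γ * N * (2 * K) +
      γ * N * (5 * (K * Real.log T) * G.diam + 2 * √(2 * Real.log T) * (3 * √(2 * (K * T)))) := by
    ring
  rw [hsplit]
  linarith

/-- The final arithmetic: all contributions are of the order of the claimed bound. -/
theorem regret_terms_le {K D T : ℕ} (hK : 1 ≤ K) (hD : K = 1 ∨ 1 ≤ D) (hT : 2 ≤ T) :
    2 * K + 5 * (K * Real.log T) * D + 2 * √(2 * Real.log T) * (3 * √(2 * (K * T))) +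
      2 * K * (D + 1) ≤ 40 * (Real.log T * (√(K * T) + D * K)) := by
  have hTR : (2 : ℝ) ≤ T := by exact_mod_cast hT
  have hKR : (1 : ℝ) ≤ K := by exact_mod_cast hK
  have hDR : (0 : ℝ) ≤ D := Nat.cast_nonneg D
  have hlog : 0.69 ≤ Real.log T := by
    have := Real.log_two_gt_d9
    have := Real.log_le_log (by norm_num) hTR
    linarith
  set L := Real.log T
  set S := √((K : ℝ) * T) with hS
  have hS1 : 1 ≤ S := Real.one_le_sqrt.2 (by nlinarith)
  have hsq : √(2 * L) * √(2 * (K * T)) ≤ 2.5 * L * S := by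
    rw [Real.sqrt_mul (by norm_num : (0 : ℝ) ≤ 2) L, Real.sqrt_mul (by norm_num) (_ * _), ← hS]
    have h2 : √2 * √2 = (2 : ℝ) := Real.mul_self_sqrt (by norm_num)
    have h3 : √L ≤ 1.25 * L := Real.sqrt_le_iff.2 ⟨by linarith, by nlinarith⟩
    calc √2 * √L * (√2 * S) = (√2 * √2) * (√L * S) := by ring
      _ ≤ 2 * (1.25 * L * S) := by rw [h2]; gcongr
      _ = _ := by ring
  -- For `D ≥ 1` the second term suffices; `D = 0` leaves only `K = 1`, where `S ≥ 1`.
  have hKS : (K : ℝ) ≤ S + D * K := by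
    rcases hD with rfl | hD
    · have : 0 ≤ (D : ℝ) * (1 : ℕ) := by positivity
      push_cast at *
      linarith
    · have : (1 : ℝ) ≤ D := by exact_mod_cast hD
      nlinarith
  have hDK : (0 : ℝ) ≤ D * K := by positivity
  have e1 : S + D * K ≤ 1.5 * (L * (S + D * K)) := by nlinarith
  have e2 : (0 : ℝ) ≤ L * S := by nlinarith
  have e3 : (0 : ℝ) ≤ L * (D * K) := by positivity
  nlinarith

end Pathwise

/-! ### Concentration of the empirical means -/

section Concentration

variable {Ω : Type*} {mΩ : MeasurableSpace Ω} {ρ : Measure Ω} {K N : ℕ} {P : Fin K → Measure ℝ}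
  {ℱ : Filtration ℕ mΩ} {X : ℕ → Fin K → Ω → ℝ} {pos : ℕ → Fin N → Ω → Fin K}

theorem IsRewardProcess.measurable (hX : IsRewardProcess ρ P ℱ X) (t : ℕ) (k : Fin K) :
    Measurable (X (t + 1) k) :=
  (hX.adapted t k).mono (ℱ.le _) le_rfl

theorem IsRewardProcess.ae_mem_Icc (hX : IsRewardProcess ρ P ℱ X)
    (hP : ∀ k, IsProbabilityMeasure (P k)) (hP01 : ∀ k, P k (Set.Icc 0 1) = 1) (t : ℕ)
    (k : Fin K) : ∀ᵐ ω ∂ρ, X (t + 1) k ω ∈ Set.Icc (0 : ℝ) 1 := by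
  have h : ∀ᵐ y ∂(P k), y ∈ Set.Icc (0 : ℝ) 1 :=
    (prob_compl_eq_zero_iff measurableSet_Icc).2 (hP01 k)
  rw [← hX.law t k] at h
  exact ae_of_ae_map (hX.measurable t k).aemeasurable h

theorem IsRewardProcess.integral_eq (hX : IsRewardProcess ρ P ℱ X) (t : ℕ) (k : Fin K) :
    ∫ ω, X (t + 1) k ω ∂ρ = ∫ y, y ∂(P k) := by
  rw [← hX.law t k]
  exact (integral_map (hX.measurable t k).aemeasurable (f := fun y => y)
    aestronglyMeasurable_id).symm

theorem IsRewardProcess.indep (hX : IsRewardProcess ρ P ℱ X) (t : ℕ) (k : Fin K) :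
    Indep (ℱ t) (MeasurableSpace.comap (X (t + 1) k) inferInstance) ρ := by
  refine indep_of_indep_of_le_right (hX.indep_past t).symm ?_
  rintro _ ⟨s, hs, rfl⟩
  exact ⟨(fun y : Fin K → ℝ => y k) ⁻¹' s, measurable_pi_apply k hs, rfl⟩

/-- Hoeffding's lemma: a variable in `[0, 1]` is subgaussian with variance proxy `1 / 4`, whence the
exponent `l ^ 2 / 8`. -/
theorem IsRewardProcess.lintegral_exp_le [IsProbabilityMeasure ρ]
    (hX : IsRewardProcess ρ P ℱ X)
    (hP : ∀ k, IsProbabilityMeasure (P k)) (hP01 : ∀ k, P k (Set.Icc 0 1) = 1) (t : ℕ)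
    (k : Fin K) (l : ℝ) :
    ∫⁻ ω, ENNReal.ofReal (Real.exp (l * (X (t + 1) k ω - ∫ y, y ∂(P k)) - l ^ 2 / 8)) ∂ρ ≤ 1 := by
  have h := hasSubgaussianMGF_of_mem_Icc (hX.measurable t k).aemeasurable
    (hX.ae_mem_Icc hP hP01 t k)
  rw [hX.integral_eq] at h
  have h1 := h.mgf_le l
  have h2 : ((((‖(1 : ℝ) - 0‖₊ / 2) ^ 2 : NNReal) : ℝ) * l ^ 2 / 2) = l ^ 2 / 8 := by
    simp
    ring
  rw [h2, mgf] at h1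
  simp only [Real.exp_sub _ (l ^ 2 / 8)]
  rw [← ofReal_integral_eq_lintegral_ofReal ((h.integrable_exp_mul l).div_const _)
    (Filter.Eventually.of_forall fun _ => by positivity), ENNReal.ofReal_le_one, integral_div]
  exact (div_le_one (Real.exp_pos _)).2 h1

/-- The sum of the centred rewards of node `k` observed before time `t`. -/
noncomputable def centredSum (P : Fin K → Measure ℝ) (X : ℕ → Fin K → Ω → ℝ)
    (pos : ℕ → Fin N → Ω → Fin K) (k : Fin K) (t : ℕ) (ω : Ω) : ℝ :=
  ∑ s ∈ sampleTimes (fun t i => pos t i ω) t k, (X s k ω - ∫ y, y ∂(P k))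

/-- The exponential supermartingale of the centred rewards of node `k`. -/
noncomputable def expProcess (P : Fin K → Measure ℝ) (X : ℕ → Fin K → Ω → ℝ)
    (pos : ℕ → Fin N → Ω → Fin K) (k : Fin K) (l : ℝ) (t : ℕ) (ω : Ω) : ENNReal :=
  ENNReal.ofReal (Real.exp (l * centredSum P X pos k t ω -
    l ^ 2 / 8 * numSamples (fun t i => pos t i ω) t k))

theorem expProcess_one (k : Fin K) (l : ℝ) (ω : Ω) : expProcess P X pos k l 1 ω = 1 := by
  simp [expProcess, centredSum, sampleTimes, numSamples]

/-- The event that node `k` is occupied at time `t`. -/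
def occupied (pos : ℕ → Fin N → Ω → Fin K) (k : Fin K) (t : ℕ) : Set Ω :=
  {ω | 0 < count (fun i => pos t i ω) k}

theorem measurableSet_occupied (hpos : ∀ t i, Measurable[ℱ t] (pos (t + 1) i)) (k : Fin K)
    (t : ℕ) : MeasurableSet[ℱ t] (occupied pos k (t + 1)) := by
  have h : Measurable[ℱ t] fun ω i => pos (t + 1) i ω :=
    @measurable_pi_lambda _ _ _ (ℱ t) _ _ fun i => hpos t i
  exact h (MeasurableSet.of_discrete (s := {a : Fin N → Fin K | 0 < count a k}))

/-- This separates what is known before step `t` from the factor carrying the new reward, so that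
independence applies on the occupied event. -/
theorem expProcess_succ (k : Fin K) (l : ℝ) {t : ℕ} (ht : 1 ≤ t) (ω : Ω) :
    expProcess P X pos k l (t + 1) ω =
      (occupied pos k t)ᶜ.indicator (expProcess P X pos k l t) ω +
      (occupied pos k t).indicator (expProcess P X pos k l t) ω *
        ENNReal.ofReal (Real.exp (l * (X t k ω - ∫ y, y ∂(P k)) - l ^ 2 / 8)) := by
  by_cases h : 0 < count (fun i => pos t i ω) k
  · have h1 : ω ∈ occupied pos k t := h
    rw [Set.indicator_of_notMem (by simpa using h1), Set.indicator_of_mem h1, zero_add]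
    unfold expProcess centredSum
    rw [sampleTimes_succ ht, numSamples_succ ht, if_pos h, if_pos h,
      Finset.sum_insert (notMem_sampleTimes t), ← ENNReal.ofReal_mul (Real.exp_pos _).le,
      ← Real.exp_add]
    push_cast
    ring_nf
  · have h1 : ω ∉ occupied pos k t := h
    rw [Set.indicator_of_mem (by simpa using h1), Set.indicator_of_notMem h1, zero_mul, add_zero]
    unfold expProcess centredSum
    rw [sampleTimes_succ ht, numSamples_succ ht, if_neg h, if_neg h, add_zero]

theorem measurable_expProcess (hX : IsRewardProcess ρ P ℱ X)
    (hpos : ∀ t i, Measurable[ℱ t] (pos (t + 1) i)) (k : Fin K) (l : ℝ) (t : ℕ) :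
    Measurable[ℱ t] (expProcess P X pos k l (t + 1)) := by
  induction t with
  | zero =>
    rw [show expProcess P X pos k l (0 + 1) = fun _ => 1 from funext (expProcess_one k l)]
    exact measurable_const
  | succ t ih =>
    rw [show expProcess P X pos k l (t + 1 + 1) = _ from
      funext (expProcess_succ k l (Nat.le_add_left 1 t))]
    have hle := ℱ.mono (Nat.le_add_right t 1)
    have hM := ih.mono hle le_rfl
    have hA := hle _ (measurableSet_occupied hpos k t)
    have hY := hX.adapted t k
    refine (hM.indicator hA.compl).add ((hM.indicator hA).mul ?_)
    exact (Real.measurable_exp.comp (((hY.sub_const _).const_mul l).sub_const _)).ennreal_ofReal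

/-- Supermartingale property: the process either stays put or is multiplied by a factor independent
of the past with mean at most one. -/
theorem lintegral_expProcess_le [IsProbabilityMeasure ρ] (hX : IsRewardProcess ρ P ℱ X)
    (hP : ∀ k, IsProbabilityMeasure (P k)) (hP01 : ∀ k, P k (Set.Icc 0 1) = 1)
    (hpos : ∀ t i, Measurable[ℱ t] (pos (t + 1) i)) (k : Fin K) (l : ℝ) (t : ℕ) :
    ∫⁻ ω, expProcess P X pos k l (t + 1) ω ∂ρ ≤ 1 := by
  induction t with
  | zero => simp [expProcess_one]
  | succ t ih =>
    simp only [expProcess_succ k l (Nat.le_add_left 1 t)]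
    have hM := measurable_expProcess hX hpos k l t
    have hA := measurableSet_occupied hpos k t
    have hA' := ℱ.le t _ hA
    have hZ : Measurable[MeasurableSpace.comap (X (t + 1) k) inferInstance] fun ω =>
        ENNReal.ofReal (Real.exp (l * (X (t + 1) k ω - ∫ y, y ∂(P k)) - l ^ 2 / 8)) :=
      (Real.measurable_exp.comp
        ((((comap_measurable (X (t + 1) k)).sub_const _).const_mul l).sub_const _)).ennreal_ofReal
    rw [lintegral_add_left ((hM.mono (ℱ.le t) le_rfl).indicator hA'.compl),
      lintegral_mul_eq_lintegral_mul_lintegral_of_independent_measurableSpace (ℱ.le t)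
        (hX.measurable t k).comap_le (hX.indep t k) (hM.indicator hA) hZ]
    calc _ ≤ ∫⁻ ω, (occupied pos k (t + 1))ᶜ.indicator (expProcess P X pos k l (t + 1)) ω ∂ρ +
          (∫⁻ ω, (occupied pos k (t + 1)).indicator (expProcess P X pos k l (t + 1)) ω ∂ρ) * 1 := by
          gcongr
          exact hX.lintegral_exp_le hP hP01 t k l
      _ = ∫⁻ ω, expProcess P X pos k l (t + 1) ω ∂ρ := by
          rw [mul_one, lintegral_indicator hA'.compl, lintegral_indicator hA', add_comm,
            lintegral_add_compl _ hA']
      _ ≤ 1 := ih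

/-- The event that the exponential process with parameter `l` is large at time `t`. -/
def largeEvent (P : Fin K → Measure ℝ) (X : ℕ → Fin K → Ω → ℝ)
    (pos : ℕ → Fin N → Ω → Fin K) (t : ℕ) (k : Fin K) (l : ℝ) : Set Ω :=
  {ω | ((t : ENNReal) ^ 4) ≤ expProcess P X pos k l t ω}

theorem measurableSet_largeEvent (hX : IsRewardProcess ρ P ℱ X)
    (hpos : ∀ t i, Measurable[ℱ t] (pos (t + 1) i)) {t : ℕ} (ht : 1 ≤ t) (k : Fin K) (l : ℝ) :
    MeasurableSet (largeEvent P X pos t k l) := by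
  obtain ⟨t, rfl⟩ := Nat.exists_eq_add_of_le' ht
  exact measurableSet_le measurable_const
    ((measurable_expProcess hX hpos k l t).mono (ℱ.le t) le_rfl)

/-- Markov's inequality; the fourth power leaves room for a union over up to `t` sample counts. -/
theorem measureReal_largeEvent_le [IsProbabilityMeasure ρ] (hX : IsRewardProcess ρ P ℱ X)
    (hP : ∀ k, IsProbabilityMeasure (P k)) (hP01 : ∀ k, P k (Set.Icc 0 1) = 1)
    (hpos : ∀ t i, Measurable[ℱ t] (pos (t + 1) i)) {t : ℕ} (ht : 1 ≤ t) (k : Fin K) (l : ℝ) :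
    ρ.real (largeEvent P X pos t k l) ≤ 1 / (t : ℝ) ^ 4 := by
  obtain ⟨t, rfl⟩ := Nat.exists_eq_add_of_le' ht
  have h1 := mul_meas_ge_le_lintegral ((measurable_expProcess hX hpos k l t).mono (ℱ.le t) le_rfl)
    (((t + 1 : ℕ) : ENNReal) ^ 4) (μ := ρ)
  have h2 := ENNReal.toReal_mono ENNReal.one_ne_top
    (h1.trans (lintegral_expProcess_le hX hP hP01 hpos k l t))
  rw [ENNReal.toReal_mul, ENNReal.toReal_pow, ENNReal.toReal_natCast, ENNReal.toReal_one] at h2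
  rw [le_div_iff₀ (by positivity), mul_comm]
  exact h2

/-- If the confidence bound of `k` fails at time `t`, one of the exponential processes is
large. -/
theorem mem_largeEvent_of_lt {t : ℕ} (ht : 1 ≤ t) {k : Fin K} {ω : Ω} {n : ℕ} (hn : 0 < n)
    (hnum : numSamples (fun t i => pos t i ω) t k = n)
    (hlt : confRadius (fun t i => pos t i ω) t k <
      |empMean (fun t i => pos t i ω) (fun t k => X t k ω) t k - ∫ y, y ∂(P k)|) :
    ω ∈ largeEvent P X pos t k (4 * √(2 * Real.log t / n)) ∨
      ω ∈ largeEvent P X pos t k (-(4 * √(2 * Real.log t / n))) := by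
  have hnR : (0 : ℝ) < n := by exact_mod_cast hn
  have htR : (0 : ℝ) < t := by exact_mod_cast ht
  have hL := Real.log_natCast_nonneg t
  set r := √(2 * Real.log t / n) with hr
  have hr0 : 0 ≤ r := Real.sqrt_nonneg _
  have hr2 : r ^ 2 * n = 2 * Real.log t := by
    rw [hr, Real.sq_sqrt (by positivity)]
    field_simp
  have hmean : empMean (fun t i => pos t i ω) (fun t k => X t k ω) t k - ∫ y, y ∂(P k) =
      centredSum P X pos k t ω / n := by
    unfold empMean centredSum
    rw [Finset.sum_sub_distrib, Finset.sum_const, nsmul_eq_mul, hnum]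
    rw [show (sampleTimes (fun t i => pos t i ω) t k).card = n from hnum]
    field_simp
  rw [confRadius, hnum, ← hr, hmean, abs_div, abs_of_pos hnR, lt_div_iff₀ hnR] at hlt
  -- `l = ±4r` is the optimal Chernoff parameter at deviation `r`: the exponent is at least `4r² n -
  -- 2r² n = 4 log t`.
  have hkey : ∀ l, l ^ 2 = 16 * r ^ 2 → 4 * r * |centredSum P X pos k t ω| =
      l * centredSum P X pos k t ω → ω ∈ largeEvent P X pos t k l := by
    intro l hl habs
    have h1 : 4 * Real.log t ≤ l * centredSum P X pos k t ω - l ^ 2 / 8 * n := by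
      rw [← habs, hl]
      have := mul_le_mul_of_nonneg_left hlt.le hr0
      nlinarith
    have h2 : (t : ENNReal) ^ 4 = ENNReal.ofReal (Real.exp (4 * Real.log t)) := by
      rw [show 4 * Real.log t = ((4 : ℕ) : ℝ) * Real.log t by norm_num, Real.exp_nat_mul,
        Real.exp_log htR, ENNReal.ofReal_pow htR.le, ENNReal.ofReal_natCast]
    change (t : ENNReal) ^ 4 ≤ expProcess P X pos k l t ω
    rw [h2, expProcess, hnum]
    exact ENNReal.ofReal_le_ofReal (Real.exp_le_exp.2 h1)
  rcases le_total 0 (centredSum P X pos k t ω) with h0 | h0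
  · exact Or.inl (hkey _ (by ring) (by rw [abs_of_nonneg h0]))
  · exact Or.inr (hkey _ (by ring) (by rw [abs_of_nonpos h0]; ring))

/-- The sample count is random and the exponential parameter depends on it, so the union runs over
all nodes, all counts below `t` and both signs. -/
theorem exists_measurableSet_isGoodTime [IsProbabilityMeasure ρ] (hX : IsRewardProcess ρ P ℱ X)
    (hP : ∀ k, IsProbabilityMeasure (P k)) (hP01 : ∀ k, P k (Set.Icc 0 1) = 1)
    (hpos : ∀ t i, Measurable[ℱ t] (pos (t + 1) i)) {t : ℕ} (ht : 1 ≤ t) :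
    ∃ B : Set Ω, MeasurableSet B ∧ ρ.real B ≤ 2 * K / (t : ℝ) ^ 3 ∧
      ∀ ω ∉ B, IsGoodTime (fun k => ∫ y, y ∂(P k)) (fun t i => pos t i ω)
        (fun t k => X t k ω) t := by
  let E : Fin K × ℕ → Set Ω := fun q =>
    largeEvent P X pos t q.1 (4 * √(2 * Real.log t / q.2)) ∪
      largeEvent P X pos t q.1 (-(4 * √(2 * Real.log t / q.2)))
  refine ⟨⋃ q ∈ Finset.univ ×ˢ Finset.Ico 1 t, E q, ?_, ?_, ?_⟩
  · exact Finset.measurableSet_biUnion _ fun q _ =>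
      (measurableSet_largeEvent hX hpos ht _ _).union (measurableSet_largeEvent hX hpos ht _ _)
  · refine (measureReal_biUnion_finset_le _ _).trans ?_
    have h1 : ∀ q ∈ Finset.univ ×ˢ Finset.Ico 1 t, ρ.real (E q) ≤ 2 / (t : ℝ) ^ 4 := by
      intro q _
      refine (measureReal_union_le _ _).trans ?_
      have h1 := measureReal_largeEvent_le hX hP hP01 hpos ht q.1 (4 * √(2 * Real.log t / q.2))
      have h2 := measureReal_largeEvent_le hX hP hP01 hpos ht q.1 (-(4 * √(2 * Real.log t / q.2)))
      calc _ ≤ 1 / (t : ℝ) ^ 4 + 1 / (t : ℝ) ^ 4 := add_le_add h1 h2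
        _ = _ := by ring
    refine (Finset.sum_le_card_nsmul _ _ _ h1).trans ?_
    rw [Finset.card_product, Finset.card_univ, Fintype.card_fin, Nat.card_Ico, nsmul_eq_mul]
    have htR : (0 : ℝ) < t := by exact_mod_cast ht
    have h2 : ((t - 1 : ℕ) : ℝ) ≤ t := by exact_mod_cast Nat.sub_le t 1
    calc ((K * (t - 1) : ℕ) : ℝ) * (2 / (t : ℝ) ^ 4) ≤ (K * t) * (2 / (t : ℝ) ^ 4) := by
          push_cast
          gcongr
      _ = _ := by field_simp
  · intro ω hω k hk
    by_contra hcon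
    have hn := numSamples_add_one_le (pos := fun t i => pos t i ω) (k := k) ht
    refine hω (Set.mem_biUnion (x := (k, numSamples (fun t i => pos t i ω) t k)) ?_
      (mem_largeEvent_of_lt ht hk rfl (not_le.1 hcon)))
    simp only [Finset.mem_product, Finset.mem_univ, Finset.mem_Ico, true_and, Finset.mem_coe]
    omega

end Concentration

/-! ### Expected regret -/

section Expectation

variable {Ω : Type*} {mΩ : MeasurableSpace Ω} {ρ : Measure Ω} {K N : ℕ} {P : Fin K → Measure ℝ}
  {ℱ : Filtration ℕ mΩ} {X : ℕ → Fin K → Ω → ℝ} {pos : ℕ → Fin N → Ω → Fin K}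
  {f : Fin K → ℕ → ℝ} {γ : ℝ} {Cstar : Fin K → ℕ}

theorem IsWeight.integrable_count [IsProbabilityMeasure ρ] (hf : IsWeight f γ) (hγ : 0 ≤ γ)
    (hpos : ∀ t i, Measurable[ℱ t] (pos (t + 1) i)) (t : ℕ) (k : Fin K) :
    Measurable[ℱ t] (fun ω => f k (count (fun i => pos (t + 1) i ω) k)) ∧
      Integrable (fun ω => f k (count (fun i => pos (t + 1) i ω) k)) ρ := by
  have h : Measurable[ℱ t] fun ω i => pos (t + 1) i ω :=
    @measurable_pi_lambda _ _ _ (ℱ t) _ _ fun i => hpos t i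
  have h1 : Measurable[ℱ t] (fun ω => f k (count (fun i => pos (t + 1) i ω) k)) :=
    (Measurable.of_discrete (f := fun a : Fin N → Fin K => f k (count a k))).comp h
  refine ⟨h1, Integrable.of_bound (h1.mono (ℱ.le t) le_rfl).aestronglyMeasurable (γ * N)
    (Filter.Eventually.of_forall fun ω => ?_)⟩
  rw [Real.norm_of_nonneg (hf.nonneg _ _)]
  refine (hf.le _ _).trans (mul_le_mul_of_nonneg_left ?_ hγ)
  have := Finset.card_filter_le Finset.univ fun i => pos (t + 1) i ω = k
  rw [Finset.card_univ, Fintype.card_fin] at this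
  exact_mod_cast this

/-- The weight of node `k` is determined by the past and thus independent of its new reward, so the
expectation of their product factors. -/
theorem integrable_reward [IsProbabilityMeasure ρ] (hX : IsRewardProcess ρ P ℱ X)
    (hP : ∀ k, IsProbabilityMeasure (P k)) (hP01 : ∀ k, P k (Set.Icc 0 1) = 1)
    (hf : IsWeight f γ) (hγ : 0 ≤ γ) (hpos : ∀ t i, Measurable[ℱ t] (pos (t + 1) i)) (t : ℕ) :
    Integrable (fun ω => reward f (fun i => pos (t + 1) i ω) (fun k => X (t + 1) k ω)) ρ ∧
    Integrable (fun ω => reward f (fun i => pos (t + 1) i ω) (fun k => ∫ y, y ∂(P k))) ρ ∧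
    ∫ ω, reward f (fun i => pos (t + 1) i ω) (fun k => X (t + 1) k ω) ∂ρ =
      ∫ ω, reward f (fun i => pos (t + 1) i ω) (fun k => ∫ y, y ∂(P k)) ∂ρ := by
  have hc := fun k => hf.integrable_count (ρ := ρ) hγ hpos t k
  have hXi : ∀ k, Integrable (X (t + 1) k) ρ := fun k =>
    Integrable.of_mem_Icc 0 1 (hX.measurable t k).aemeasurable (hX.ae_mem_Icc hP hP01 t k)
  have hind : ∀ k, IndepFun (fun ω => f k (count (fun i => pos (t + 1) i ω) k))
      (X (t + 1) k) ρ := fun k =>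
    (IndepFun_iff_Indep _ _ _).2 (indep_of_indep_of_le_left (hX.indep t k) (hc k).1.comap_le)
  have h1 : ∀ k ∈ Finset.univ, Integrable
      (fun ω => f k (count (fun i => pos (t + 1) i ω) k) * X (t + 1) k ω) ρ := fun k _ =>
    (hind k).integrable_mul (hc k).2 (hXi k)
  have h2 : ∀ k ∈ Finset.univ, Integrable
      (fun ω => f k (count (fun i => pos (t + 1) i ω) k) * ∫ y, y ∂(P k)) ρ := fun k _ =>
    (hc k).2.mul_const _
  refine ⟨integrable_finsetSum _ h1, integrable_finsetSum _ h2, ?_⟩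
  unfold reward
  rw [integral_finsetSum _ h1, integral_finsetSum _ h2]
  refine Finset.sum_congr rfl fun k _ => ?_
  rw [(hind k).integral_fun_mul_eq_mul_integral (hc k).2.aestronglyMeasurable
    (hXi k).aestronglyMeasurable, hX.integral_eq, integral_mul_const]

theorem integral_cumRegret [IsProbabilityMeasure ρ] (hX : IsRewardProcess ρ P ℱ X)
    (hP : ∀ k, IsProbabilityMeasure (P k)) (hP01 : ∀ k, P k (Set.Icc 0 1) = 1)
    (hf : IsWeight f γ) (hγ : 0 ≤ γ) (hpos : ∀ t i, Measurable[ℱ t] (pos (t + 1) i)) (T : ℕ) :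
    Integrable (fun ω => cumRegret f (fun k => ∫ y, y ∂(P k)) Cstar
      (fun t i => pos t i ω) (fun t k => X t k ω) T) ρ ∧
    Integrable (fun ω => ∑ t ∈ Finset.Icc 1 T,
      gap f (fun k => ∫ y, y ∂(P k)) Cstar (fun i => pos t i ω)) ρ ∧
    ∫ ω, cumRegret f (fun k => ∫ y, y ∂(P k)) Cstar
      (fun t i => pos t i ω) (fun t k => X t k ω) T ∂ρ =
      ∫ ω, ∑ t ∈ Finset.Icc 1 T,
        gap f (fun k => ∫ y, y ∂(P k)) Cstar (fun i => pos t i ω) ∂ρ := by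
  have hr : ∀ t ∈ Finset.Icc 1 T, _ := fun t ht => by
    have h := integrable_reward hX hP hP01 hf hγ hpos (t - 1)
    rw [Nat.sub_add_cancel (Finset.mem_Icc.1 ht).1] at h
    exact h
  have h1 := fun t ht => (integrable_const (μ := ρ)
    (∑ k, f k (Cstar k) * ∫ y, y ∂(P k))).sub (hr t ht).1
  have h2 := fun t ht => (integrable_const (μ := ρ)
    (∑ k, f k (Cstar k) * ∫ y, y ∂(P k))).sub (hr t ht).2.1
  refine ⟨integrable_finsetSum _ h1, integrable_finsetSum _ h2, ?_⟩
  unfold cumRegret gap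
  refine (integral_finsetSum _ h1).trans (Eq.trans ?_ (integral_finsetSum _ h2).symm)
  refine Finset.sum_congr rfl fun t ht => ?_
  refine (integral_sub (integrable_const _) (hr t ht).1).trans
    (Eq.trans ?_ (integral_sub (integrable_const _) (hr t ht).2.1).symm)
  rw [(hr t ht).2.2]

theorem sum_inv_sq_le_one (T : ℕ) : ∑ t ∈ Finset.Icc 2 T, ((t : ℝ) ^ 2)⁻¹ ≤ 1 := by
  rcases Nat.lt_or_ge T 2 with h | h
  · simp [Finset.Icc_eq_empty_of_lt h]
  · have h1 := sum_Ioc_inv_sq_le_sub (α := ℝ) one_ne_zero (show 1 ≤ T by omega)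
    have h2 : Finset.Icc 2 T = Finset.Ioc 1 T := by
      ext t
      simp only [Finset.mem_Icc, Finset.mem_Ioc]
      omega
    rw [h2]
    refine h1.trans ?_
    simp

open Classical in
/-- The expected cost of the time steps at which the confidence bounds fail. -/
theorem exists_integral_isGoodTime_le [IsProbabilityMeasure ρ] (hX : IsRewardProcess ρ P ℱ X)
    (hP : ∀ k, IsProbabilityMeasure (P k)) (hP01 : ∀ k, P k (Set.Icc 0 1) = 1)
    (hpos : ∀ t i, Measurable[ℱ t] (pos (t + 1) i)) {a : ℝ} (ha : 0 ≤ a) (D T : ℕ) :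
    ∃ g : Ω → ℝ, Integrable g ρ ∧ ∫ ω, g ω ∂ρ ≤ a * (2 * K * (D + 1)) ∧
      ∀ ω, (∑ t ∈ Finset.Icc 2 T, if IsGoodTime (fun k => ∫ y, y ∂(P k))
        (fun t i => pos t i ω) (fun t k => X t k ω) t then 0 else a * (D + t)) ≤ g ω := by
  choose! B hBm hB hgood using fun (t : ℕ) (ht : 1 ≤ t) =>
    exists_measurableSet_isGoodTime hX hP hP01 hpos ht
  have hBm' : ∀ t ∈ Finset.Icc 2 T, MeasurableSet (B t) := fun t ht =>
    hBm t (by have := (Finset.mem_Icc.1 ht).1; omega)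
  have hint : ∀ t ∈ Finset.Icc 2 T,
      Integrable (fun ω => (B t).indicator (fun _ => a * (D + t : ℝ)) ω) ρ := fun t ht =>
    (integrable_const _).indicator (hBm' t ht)
  refine ⟨fun ω => ∑ t ∈ Finset.Icc 2 T, (B t).indicator (fun _ => a * (D + t : ℝ)) ω,
    integrable_finsetSum _ hint, ?_, ?_⟩
  · rw [integral_finsetSum _ hint]
    have h1 : ∀ t ∈ Finset.Icc 2 T, ∫ ω, (B t).indicator (fun _ => a * (D + t : ℝ)) ω ∂ρ ≤
        a * (2 * K * (D + 1)) * ((t : ℝ) ^ 2)⁻¹ := by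
      intro t ht
      have ht2 := (Finset.mem_Icc.1 ht).1
      have htR : (1 : ℝ) ≤ t := by exact_mod_cast (by omega : 1 ≤ t)
      rw [integral_indicator_const _ (hBm' t ht), smul_eq_mul]
      -- This turns the cost times `2K / t³` into a multiple of `1 / t²`, which sums to at most `1`
      -- from `t = 2` on.
      have h2 : (D + t : ℝ) ≤ (D + 1) * t := by
        nlinarith [mul_nonneg (Nat.cast_nonneg (α := ℝ) D) (sub_nonneg.2 htR)]
      calc ρ.real (B t) * (a * (D + t)) ≤ 2 * K / (t : ℝ) ^ 3 * (a * ((D + 1) * t)) := by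
            gcongr
            exact hB t (by omega)
        _ = _ := by field_simp
    refine (Finset.sum_le_sum h1).trans ?_
    rw [← Finset.mul_sum]
    exact mul_le_of_le_one_right (by positivity) (sum_inv_sq_le_one T)
  · intro ω
    refine Finset.sum_le_sum fun t ht => ?_
    have ht2 := (Finset.mem_Icc.1 ht).1
    by_cases hω : ω ∈ B t
    · rw [Set.indicator_of_mem hω]
      split_ifs
      · positivity
      · exact le_rfl
    · rw [Set.indicator_of_notMem hω, if_pos (hgood t (by omega) ω hω)]

end Expectation

end MultiGUCB

theorem theorem1 :
    ∃ B : ℝ, 0 < B ∧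
      ∀ (N K : ℕ) (_hN : 1 ≤ N)
        (G : SimpleGraph (Fin K)) (_hG : G.Connected)
        (P : Fin K → Measure ℝ) (_hP : ∀ k, IsProbabilityMeasure (P k))
        (_hP01 : ∀ k, P k (Set.Icc 0 1) = 1)
        (f : Fin K → ℕ → ℝ) (γ : ℝ)
        (_hf_nonneg : ∀ k c, 0 ≤ f k c) (_hf_one : ∀ k, f k 1 = 1)
        (_hf_le : ∀ k c, f k c ≤ γ * c)
        (start : Fin N → Fin K)
        (Cstar : Fin K → ℕ) (_hCstar : MultiGUCB.IsOptimalAlloc N f (fun k => ∫ x, x ∂P k) Cstar)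
        (Ω : Type*) (mΩ : MeasurableSpace Ω) (ρ : Measure Ω) (_hρ : IsProbabilityMeasure ρ)
        (ℱ : Filtration ℕ mΩ) (X : ℕ → Fin K → Ω → ℝ)
        (_hX : MultiGUCB.IsRewardProcess ρ P ℱ X)
        (pos : ℕ → Fin N → Ω → Fin K)
        (_hpos : MultiGUCB.IsExecution ρ G f start ℱ X pos)
        (T : ℕ) (_hT : 2 ≤ T),
        Integrable (fun ω => MultiGUCB.cumRegret f (fun k => ∫ x, x ∂P k) Cstar
            (fun t i => pos t i ω) (fun t k => X t k ω) T) ρ ∧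
        ∫ ω, MultiGUCB.cumRegret f (fun k => ∫ x, x ∂P k) Cstar
            (fun t i => pos t i ω) (fun t k => X t k ω) T ∂ρ
          ≤ B * (γ * N * Real.log T * (Real.sqrt (K * T) + G.diam * K)) := by
  refine ⟨40, by norm_num, ?_⟩
  intro N K hN G hG P hP hP01 f γ hf0 hf1 hfle start Cstar hCstar Ω mΩ ρ hρ ℱ X hX pos hpos T hT
  have hf : MultiGUCB.IsWeight f γ := ⟨hf0, hfle⟩
  have hne := hG.nonempty
  have k₀ := hne.some
  have hK : 1 ≤ K := Fin.pos k₀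
  have hγ : 0 ≤ γ := by
    have h := hfle k₀ 1
    rw [hf1, Nat.cast_one, mul_one] at h
    linarith
  -- `diam` also takes the value `0` when the extended diameter is infinite; connectedness excludes
  -- this.
  have hD : K = 1 ∨ 1 ≤ G.diam := by
    rcases Nat.lt_or_ge 1 K with h | h
    · right
      by_contra hD
      have := SimpleGraph.diam_eq_zero.1 (Nat.lt_one_iff.1 (not_le.1 hD))
      rcases this with h1 | h1
      · exact (SimpleGraph.connected_iff_ediam_ne_top.1 hG) h1
      · have := Fin.subsingleton_iff_le_one.1 h1
        omega
    · left
      omega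
  have hm : ∀ k, (0 : ℝ) ≤ ∫ y, y ∂(P k) ∧ ∫ y, y ∂(P k) ≤ 1 := by
    intro k
    have h : ∀ᵐ y ∂(P k), y ∈ Set.Icc (0 : ℝ) 1 :=
      (prob_compl_eq_zero_iff measurableSet_Icc).2 (hP01 k)
    refine ⟨integral_nonneg_of_ae (h.mono fun y hy => hy.1), ?_⟩
    have h1 := integral_mono_ae (Integrable.of_mem_Icc 0 1 aemeasurable_id h)
      (integrable_const (1 : ℝ)) (h.mono fun y hy => hy.2)
    simpa using h1
  obtain ⟨hint, hgint, heq⟩ := MultiGUCB.integral_cumRegret (Cstar := Cstar) hX hP hP01 hf hγ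
    hpos.predictable T
  refine ⟨hint, ?_⟩
  have hγN : 0 ≤ γ * N := by positivity
  obtain ⟨g, hg, hgle, hbound⟩ := MultiGUCB.exists_integral_isGoodTime_le hX hP hP01
    hpos.predictable hγN G.diam T
  rw [heq]
  have hmono := integral_mono_ae hgint ((integrable_const (γ * N * (2 * K +
    5 * (K * Real.log T) * G.diam + 2 * √(2 * Real.log T) * (3 * √(2 * (K * T)))))).add hg)
    (hpos.run.mono fun ω hω => (hω.sum_gap_le hG hf hγ (fun k => (hm k).1)
      (fun k => (hm k).2) hCstar hT).trans (add_le_add_right (hbound ω) _))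
  refine hmono.trans ?_
  rw [integral_add' (integrable_const _) hg, integral_const, probReal_univ, one_smul]
  have hfin := mul_le_mul_of_nonneg_left (MultiGUCB.regret_terms_le hK hD hT) hγN
  linarith
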